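/- Let $\Lambda$ and $\Delta$ be commutative local uniserial rings (i.e. local rings whose ideals form a chain) of the same finite length $n$, with residue fields isomorphic to a field $k$. For such a ring $\Lambda$ with maximal ideal $\operatorname{rad}\Lambda$, let $\mathcal S_2(\Lambda)$ be the category whose objects are the pairs $(B;A)$ of a finitely generated $\Lambda$-module $B$ and a submodule $A\subseteq B$ with $(\operatorname{rad}\Lambda)^2A=0$, and whose morphisms $(B;A)\to(D;C)$ are the $\Lambda$-linear maps $f:B\to D$ with $f(A)\subseteq C$. Put $A^-=\operatorname{rad}A=(\operatorname{rad}\Lambda)A$ and $A^+=A+\operatorname{soc}B$, and let $\mathcal N_\Lambda$ be the categorical ideal of $\mathcal S_2(\Lambda)$ consisting of the morphisms $f:(B;A)\to(D;C)$ with $f(A^+)\subseteq C^-$. Let $\mathcal P_n$ be the poset that is the disjoint union of the chain $n-1<\dots<2<1$ and two further points $1'$, $1''$, each comparable only to itself. Let $\operatorname{rep}'_k\mathcal P_n$ be the category of finite-dimensional $k$-vector spaces $V^0$ with subspaces $V^i\subseteq V^0$ for $i\in\mathcal P_n$, such that $V^i\subseteq V^j$ whenever $i<j$ in $\mathcal P_n$,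 and such that $V^{n-1}\subseteq V^{1'}$ and $V^{1'}+V^{1''}=V^0$ (for $n=1$, $V^{n-1}$ is the total space $V^0$); morphisms are the linear maps of total spaces respecting all the subspaces. Then the factor categories $\mathcal S_2(\Lambda)/\mathcal N_\Lambda$ and $\mathcal S_2(\Delta)/\mathcal N_\Delta$ are both equivalent to $\operatorname{rep}'_k\mathcal P_n$, and hence equivalent to each other, all by additive equivalences. For example, for every prime $p$ and every $n\ge 1$, the categories $\mathcal S_2(\mathbb Z/p^n)/\mathcal N$ and $\mathcal S_2(\mathbb F_p[T]/(T^n))/\mathcal N$ are equivalent. -/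

import Mathlib

open CategoryTheory

universe u v w w'

/-- A module is uniserial if its submodules form a chain. -/
def IsUniserialModule (R : Type u) (M : Type v) [Ring R] [AddCommGroup M] [Module R M] : Prop :=
  ∀ N N' : Submodule R M, N ≤ N' ∨ N' ≤ N

/-- A commutative ring is uniserial if its ideals form a chain. -/
def IsUniserialRing (R : Type u) [CommRing R] : Prop :=
  IsUniserialModule R R

/-! ### Pairs `(B; A)` of a finitely generated module and a submodule -/

section Pairs

/-- An object `(B; A)` of the category `𝒮(Λ)`: a finitely generated `Λ`-module `B` together with a
submodule `A`. -/
structure SubmodulePair (Λ : Type u) [CommRing Λ] : Type (u + 1) where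
  B : Type u
  [addCommGroup : AddCommGroup B]
  [module : Module Λ B]
  [finite : Module.Finite Λ B]
  A : Submodule Λ B

attribute [instance] SubmodulePair.addCommGroup SubmodulePair.module SubmodulePair.finite

namespace SubmodulePair

variable {Λ : Type u} [CommRing Λ]

/-- The `Λ`-linear maps `f : B → D` such that `f(A) ⊆ C`. -/
def homs (X Y : SubmodulePair Λ) : Submodule Λ (X.B →ₗ[Λ] Y.B) where
  carrier := {f | ∀ a ∈ X.A, f a ∈ Y.A}
  add_mem' hf hg a ha := Y.A.add_mem (hf a ha) (hg a ha)
  zero_mem' _ _ := Y.A.zero_mem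
  smul_mem' c _ hf a ha := Y.A.smul_mem c (hf a ha)

instance : Category.{u} (SubmodulePair Λ) where
  Hom X Y := homs X Y
  id X := ⟨LinearMap.id, fun _ ha => ha⟩
  comp f g := ⟨g.1 ∘ₗ f.1, fun a ha => g.2 _ (f.2 a ha)⟩

/-- The linear map `B → D` underlying a morphism `(B; A) → (D; C)`. -/
def toLin {X Y : SubmodulePair Λ} (f : X ⟶ Y) : X.B →ₗ[Λ] Y.B := f.1

instance : Preadditive (SubmodulePair Λ) where
  homGroup X Y := inferInstanceAs (AddCommGroup (homs X Y))
  add_comp _ _ _ f f' g := Subtype.ext (LinearMap.comp_add f.1 f'.1 g.1)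
  comp_add _ _ _ f g g' := Subtype.ext (LinearMap.add_comp f.1 g'.1 g.1)

/-- `A⁻ = rad A`. -/
def Aminus (X : SubmodulePair Λ) : Submodule Λ X.B := Ring.jacobson Λ • X.A

/-- `soc B`: for a local ring `Λ`, the largest semisimple submodule of `B` consists of the elements
that are annihilated by `rad Λ`. -/
def soc (X : SubmodulePair Λ) : Submodule Λ X.B :=
  Submodule.torsionBySet Λ X.B (Ring.jacobson Λ : Set Λ)

/-- `A⁺ = A + soc B`. -/
def Aplus (X : SubmodulePair Λ) : Submodule Λ X.B := X.A ⊔ X.soc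

/-- The pairs `(B; A)` such that `(rad Λ)^m A = 0`. If `p` generates `rad Λ`, this says `p^m A = 0`. -/
def bounded (Λ : Type u) [CommRing Λ] (m : ℕ) : ObjectProperty (SubmodulePair Λ) :=
  fun X => (Ring.jacobson Λ) ^ m • X.A = ⊥

theorem map_mem_Aplus {X Y : SubmodulePair Λ} (f : X ⟶ Y) {b : X.B} (hb : b ∈ X.Aplus) :
    toLin f b ∈ Y.Aplus := by
  obtain ⟨a, ha, s, hs, rfl⟩ := Submodule.mem_sup.1 hb
  rw [map_add]
  refine Submodule.add_mem_sup (f.2 a ha) ?_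
  rw [soc, Submodule.mem_torsionBySet_iff] at hs ⊢
  intro c
  rw [← map_smul, hs c, map_zero]

theorem map_mem_Aminus {X Y : SubmodulePair Λ} (f : X ⟶ Y) {b : X.B} (hb : b ∈ X.Aminus) :
    toLin f b ∈ Y.Aminus := by
  have h : X.Aminus.map (toLin f) ≤ Y.Aminus := by
    rw [Aminus, Submodule.map_smul'']
    refine Submodule.smul_mono le_rfl ?_
    rintro _ ⟨a, ha, rfl⟩
    exact f.2 a ha
  exact h ⟨b, hb, rfl⟩

end SubmodulePair

/-- The category `𝒮_m(Λ)`. -/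
abbrev BoundedPair (Λ : Type u) [CommRing Λ] (m : ℕ) : Type (u + 1) :=
  (SubmodulePair.bounded Λ m).FullSubcategory

namespace BoundedPair

variable {Λ : Type u} [CommRing Λ]

/-- The categorical ideal `𝒩` of `𝒮₂(Λ)`: the subgroup of the morphisms `f : (B; A) → (D; C)` such
that `f(A⁺) ⊆ C⁻`. -/
def idealN (X Y : BoundedPair Λ 2) : AddSubgroup (X ⟶ Y) where
  carrier := {f | ∀ b ∈ X.obj.Aplus, SubmodulePair.toLin f.hom b ∈ Y.obj.Aminus}
  add_mem' hf hg b hb := Y.obj.Aminus.add_mem (hf b hb) (hg b hb)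
  zero_mem' _ _ := Y.obj.Aminus.zero_mem
  neg_mem' hf b hb := Y.obj.Aminus.neg_mem (hf b hb)

theorem comp_mem_idealN_left {X Y Z : BoundedPair Λ 2} (f : X ⟶ Y) {g : Y ⟶ Z}
    (hg : g ∈ idealN Y Z) : f ≫ g ∈ idealN X Z :=
  fun _ hb => hg _ (SubmodulePair.map_mem_Aplus f.hom hb)

theorem comp_mem_idealN_right {X Y Z : BoundedPair Λ 2} {f : X ⟶ Y} (g : Y ⟶ Z)
    (hf : f ∈ idealN X Y) : f ≫ g ∈ idealN X Z :=
  fun b hb => SubmodulePair.map_mem_Aminus g.hom (hf b hb)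

/-- Two parallel morphisms of `𝒮₂(Λ)` are congruent if their difference lies in `𝒩`. -/
def relN (Λ : Type u) [CommRing Λ] : HomRel (BoundedPair Λ 2) :=
  fun X Y f g => f - g ∈ idealN X Y

instance : Congruence (relN Λ) where
  equivalence {X Y} :=
    { refl := fun f => by
        change f - f ∈ idealN X Y
        rw [sub_self]
        exact (idealN X Y).zero_mem
      symm := fun {f g} h => by
        change g - f ∈ idealN X Y
        rw [← neg_sub]
        exact (idealN X Y).neg_mem h
      trans := fun {f g k} h₁ h₂ => by
        change f - k ∈ idealN X Y
        rw [← sub_add_sub_cancel f g k]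
        exact (idealN X Y).add_mem h₁ h₂ }
  comp_left {X Y Z} f {g g'} h := by
    change f ≫ g - f ≫ g' ∈ idealN X Z
    rw [← Preadditive.comp_sub]
    exact comp_mem_idealN_left f h
  comp_right {X Y Z} {f f'} g h := by
    change f ≫ g - f' ≫ g ∈ idealN X Z
    rw [← Preadditive.sub_comp]
    exact comp_mem_idealN_right g h

theorem relN_add ⦃X Y : BoundedPair Λ 2⦄ (f₁ f₂ g₁ g₂ : X ⟶ Y) (hf : relN Λ f₁ f₂)
    (hg : relN Λ g₁ g₂) : relN Λ (f₁ + g₁) (f₂ + g₂) := by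
  change f₁ + g₁ - (f₂ + g₂) ∈ idealN X Y
  rw [add_sub_add_comm]
  exact (idealN X Y).add_mem hf hg

end BoundedPair

/-- The factor category `𝒮₂(Λ)/𝒩_Λ`. -/
abbrev S2ModN (Λ : Type u) [CommRing Λ] : Type (u + 1) :=
  CategoryTheory.Quotient (BoundedPair.relN Λ)

instance (Λ : Type u) [CommRing Λ] : Preadditive (S2ModN Λ) :=
  Quotient.preadditive (BoundedPair.relN Λ) BoundedPair.relN_add

end Pairs

/-! ### Representations of posets -/

section PosetRepresentations

/-- A finite dimensional `k`-linear representation of a poset `P`: a total space together with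
subspaces `Vⁱ`, `i ∈ P`, such that `Vⁱ ⊆ Vʲ` whenever `i ≤ j`. -/
structure PosetRep (k : Type u) [Field k] (P : Type v) [PartialOrder P] : Type (max (u + 1) v) where
  total : Type u
  [addCommGroup : AddCommGroup total]
  [module : Module k total]
  [finite : Module.Finite k total]
  sub : P →o Submodule k total

attribute [instance] PosetRep.addCommGroup PosetRep.module PosetRep.finite

namespace PosetRep

variable {k : Type u} [Field k] {P : Type v} [PartialOrder P]

/-- The linear maps between the total spaces that respect all the subspaces. -/
def homs (V W : PosetRep k P) : Submodule k (V.total →ₗ[k] W.total) where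
  carrier := {f | ∀ i, ∀ x ∈ V.sub i, f x ∈ W.sub i}
  add_mem' hf hg i x hx := (W.sub i).add_mem (hf i x hx) (hg i x hx)
  zero_mem' i _ _ := (W.sub i).zero_mem
  smul_mem' c _ hf i x hx := (W.sub i).smul_mem c (hf i x hx)

instance : Category.{u} (PosetRep k P) where
  Hom V W := homs V W
  id V := ⟨LinearMap.id, fun _ _ hx => hx⟩
  comp f g := ⟨g.1 ∘ₗ f.1, fun i x hx => g.2 i _ (f.2 i x hx)⟩

instance : Preadditive (PosetRep k P) where
  homGroup V W := inferInstanceAs (AddCommGroup (homs V W))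
  add_comp _ _ _ f f' g := Subtype.ext (LinearMap.comp_add f.1 f'.1 g.1)
  comp_add _ _ _ f g g' := Subtype.ext (LinearMap.add_comp f.1 g'.1 g.1)

end PosetRep

/-- The poset `𝒫_n`: the disjoint union of the chain `n - 1 < ⋯ < 2 < 1` and two further points
`1'` and `1''`, each of which is comparable only to itself. -/
abbrev PosetP (n : ℕ) : Type := (Set.Ico 1 n)ᵒᵈ ⊕ Unit ⊕ Unit

namespace PosetRep

variable {k : Type u} [Field k] {n : ℕ}

/-- The subspace `V^ℓ` for `1 ≤ ℓ ≤ n - 1`; for `ℓ = 0` this is the total space `V⁰`. -/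
def level (V : PosetRep k (PosetP n)) (ℓ : ℕ) : Submodule k V.total :=
  if h : ℓ ∈ Set.Ico 1 n then V.sub (Sum.inl (OrderDual.toDual ⟨ℓ, h⟩)) else ⊤

/-- The subspace `V' = V^{1'}`. -/
def prime (V : PosetRep k (PosetP n)) : Submodule k V.total := V.sub (Sum.inr (Sum.inl ()))

/-- The subspace `V'' = V^{1''}`. -/
def dprime (V : PosetRep k (PosetP n)) : Submodule k V.total := V.sub (Sum.inr (Sum.inr ()))

/-- The conditions `V^{n-1} ⊆ V'` and `V' + V'' = V⁰`. For `n = 1` the first one says `V' = V⁰`. -/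
def restricted (k : Type u) [Field k] (n : ℕ) : ObjectProperty (PosetRep k (PosetP n)) :=
  fun V => V.level (n - 1) ≤ V.prime ∧ V.prime ⊔ V.dprime = ⊤

end PosetRep

/-- The category `rep'_k 𝒫_n`. -/
abbrev RepPrime (k : Type u) [Field k] (n : ℕ) : Type (u + 1) :=
  (PosetRep.restricted k n).FullSubcategory

end PosetRepresentations

/-- Two preadditive categories are equivalent by means of an additive functor. -/
def AdditivelyEquivalent (C : Type u) [Category.{v} C] [Preadditive C]
    (D : Type w) [Category.{w'} D] [Preadditive D] : Prop :=
  ∃ e : C ≌ D, e.functor.Additive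

/-!
Let `p` generate `rad Λ`. A morphism of representations `A⁺/A⁻ → C⁺/C⁻` defines a linear relation
between `B` and `D`, whose multiple by `p` does not decrease heights. Relations with this property
extend step by step, first within the given relation and then to the graph of a linear map `B → D`.
So the functor that sends `(B; A)` to `A⁺/A⁻`, filtered by heights, is full, and its kernel is `𝒩`.
Conversely, a basis adapted to the chain of subspaces and to `V'` prescribes a direct sum `B` of
cyclic modules, one for each basis vector and of the length determined by its height and by whether
it lies in `V'`, in which `A` is obtained from `V''`.
-/

theorem krullDim_fin_succ (n : ℕ) : Order.krullDim (Fin (n + 1)) = n := by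
  refine le_antisymm (iSup_le fun s => ?_) ?_
  · have := s.length_lt_card
    rw [Fintype.card_fin] at this
    exact_mod_cast Nat.lt_succ_iff.1 this
  · exact Order.LTSeries.length_le_krullDim
      (⟨n, id, fun i => i.castSucc_lt_succ⟩ : LTSeries (Fin (n + 1)))

open IsLocalRing

section SemilinearFactor

variable {R₁ R₂ R₃ : Type*} [Semiring R₁] [Semiring R₂] [Semiring R₃] {σ₁₂ : R₁ →+* R₂}
  {σ₂₃ : R₂ →+* R₃} {σ₁₃ : R₁ →+* R₃} [RingHomCompTriple σ₁₂ σ₂₃ σ₁₃] [RingHomSurjective σ₁₂]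
  {M₁ M₂ M₃ : Type*} [AddCommGroup M₁] [AddCommGroup M₂] [AddCommGroup M₃] [Module R₁ M₁]
  [Module R₂ M₂] [Module R₃ M₃]

theorem exists_semilinear_factor {f : M₁ →ₛₗ[σ₁₂] M₂} (hf : Function.Surjective f)
    {g : M₁ →ₛₗ[σ₁₃] M₃} (hfg : ∀ x, f x = 0 → g x = 0) :
    ∃ u : M₂ →ₛₗ[σ₂₃] M₃, ∀ x, u (f x) = g x := by
  let u : M₂ → M₃ := g ∘ Function.surjInv hf
  have hu (x : M₁) : u (f x) = g x := by
    refine sub_eq_zero.1 ((map_sub g _ x).symm.trans (hfg _ ?_))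
    rw [map_sub, Function.surjInv_eq hf, sub_self]
  refine ⟨{ toFun := u, map_add' := hf.forall₂.2 fun x y => ?_, map_smul' := ?_ }, hu⟩
  · rw [← map_add, hu, hu, hu, map_add]
  · refine (RingHomSurjective.is_surjective (σ := σ₁₂)).forall.2 fun r => hf.forall.2 fun x => ?_
    rw [← map_smulₛₗ, hu, hu, map_smulₛₗ, RingHomCompTriple.comp_apply]

end SemilinearFactor

/-- A generator `p` of the maximal ideal of a local ring with nilpotency index `n`. -/
structure IsUniformizer {R : Type*} [CommRing R] [IsLocalRing R] (p : R) (n : ℕ) : Prop where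
  maximalIdeal_eq : maximalIdeal R = Ideal.span {p}
  pow_eq_zero_iff (m : ℕ) : p ^ m = 0 ↔ n ≤ m

namespace IsUniformizer

variable {R : Type*} [CommRing R] [IsLocalRing R] {p : R} {n : ℕ} (h : IsUniformizer p n)
include h

theorem pow_eq_zero : p ^ n = 0 :=
  (h.pow_eq_zero_iff n).2 le_rfl

theorem pos : 0 < n :=
  Nat.pos_of_ne_zero fun hn => one_ne_zero (by rw [← pow_zero p, ← hn, h.pow_eq_zero])

theorem isUnit_of_not_dvd {a : R} (ha : ¬p ∣ a) : IsUnit a := by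
  rwa [← Ideal.mem_span_singleton, ← h.maximalIdeal_eq, notMem_maximalIdeal] at ha

theorem map_eq_zero_iff {k : Type*} [Field k] (σ : R →+* k) {a : R} : σ a = 0 ↔ p ∣ a := by
  refine ⟨fun ha => by_contra fun hpa => ((h.isUnit_of_not_dvd hpa).map σ).ne_zero ha, ?_⟩
  rintro ⟨b, rfl⟩
  have hp : IsNilpotent p := ⟨n, h.pow_eq_zero⟩
  rw [map_mul, (hp.map σ).eq_zero, zero_mul]

theorem exists_eq_pow_mul {a : R} (ha : a ≠ 0) : ∃ j u, IsUnit u ∧ a = p ^ j * u := by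
  have hfin : FiniteMultiplicity p a :=
    ⟨n, by rwa [(h.pow_eq_zero_iff (n + 1)).2 n.le_succ, zero_dvd_iff]⟩
  obtain ⟨u, hau, hu⟩ := hfin.exists_eq_pow_mul_and_not_dvd
  exact ⟨_, u, h.isUnit_of_not_dvd hu, hau⟩

theorem pow_dvd_of_pow_mul_eq_zero {i j : ℕ} (hij : i + j ≤ n) {a : R} (ha : p ^ i * a = 0) :
    p ^ j ∣ a := by
  rcases eq_or_ne a 0 with rfl | ha₀
  · exact dvd_zero _
  obtain ⟨l, u, hu, rfl⟩ := h.exists_eq_pow_mul ha₀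
  rw [← mul_assoc, ← pow_add, hu.mul_left_eq_zero, h.pow_eq_zero_iff] at ha
  exact (pow_dvd_pow p (by lia)).mul_right u

theorem pow_add_dvd_pow_mul_iff {i j : ℕ} (hij : i + j ≤ n) {a : R} :
    p ^ (i + j) ∣ p ^ i * a ↔ p ^ j ∣ a := by
  refine ⟨fun ⟨b, hb⟩ => ?_, fun ha => pow_add p i j ▸ mul_dvd_mul_left _ ha⟩
  have hab : p ^ i * (a - p ^ j * b) = 0 := by rw [mul_sub, hb, pow_add, mul_assoc, sub_self]
  exact (dvd_sub_left (dvd_mul_right _ b)).1 (h.pow_dvd_of_pow_mul_eq_zero hij hab)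

theorem pow_dvd_pow_iff {i j : ℕ} (hi : i ≤ n) : p ^ i ∣ p ^ j ↔ i ≤ j := by
  refine ⟨fun ⟨c, hc⟩ => ?_, pow_dvd_pow p⟩
  have hpow : p ^ (n - i + j) = 0 := by
    rw [pow_add, hc, ← mul_assoc, ← pow_add, Nat.sub_add_cancel hi, h.pow_eq_zero, zero_mul]
  have := (h.pow_eq_zero_iff _).1 hpow
  lia

theorem exists_ideal_eq_span_pow (I : Ideal R) : ∃ j ≤ n, I = Ideal.span {p ^ j} := by
  classical
  have hpn : p ^ n ∈ I := by rw [h.pow_eq_zero]; exact I.zero_mem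
  have hex : ∃ j, p ^ j ∈ I := ⟨n, hpn⟩
  refine ⟨Nat.find hex, Nat.find_min' hex hpn, le_antisymm (fun a ha => ?_)
    ((Ideal.span_singleton_le_iff_mem I).2 (Nat.find_spec hex))⟩
  rw [Ideal.mem_span_singleton]
  rcases eq_or_ne a 0 with rfl | ha₀
  · exact dvd_zero _
  obtain ⟨j, u, hu, rfl⟩ := h.exists_eq_pow_mul ha₀
  rw [Ideal.mul_unit_mem_iff_mem I hu] at ha
  exact (pow_dvd_pow p (Nat.find_min' hex ha)).mul_right u

theorem isNoetherianRing : IsNoetherianRing R :=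
  have : IsPrincipalIdealRing R := ⟨fun I =>
    have ⟨j, _, hI⟩ := h.exists_ideal_eq_span_pow I
    ⟨p ^ j, hI⟩⟩
  inferInstance

theorem strictMono_span_pow :
    StrictMono fun j : Fin (n + 1) => OrderDual.toDual (Ideal.span {p ^ (j : ℕ)}) := by
  refine strictMono_of_le_iff_le fun i j => ?_
  rw [OrderDual.toDual_le_toDual, Ideal.span_singleton_le_span_singleton,
    h.pow_dvd_pow_iff (Nat.lt_succ_iff.1 i.2), Fin.le_def]

theorem length_eq : Module.length R R = n := by
  have hsurj : Function.Surjective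
      fun j : Fin (n + 1) => OrderDual.toDual (Ideal.span {p ^ (j : ℕ)}) := fun I =>
    have ⟨j, hj, hI⟩ := h.exists_ideal_eq_span_pow (OrderDual.ofDual I)
    ⟨⟨j, Nat.lt_succ_of_le hj⟩, hI.symm⟩
  have hdim := Order.krullDim_eq_of_orderIso (h.strictMono_span_pow.orderIsoOfSurjective _ hsurj)
  rw [krullDim_fin_succ, Order.krullDim_orderDual, ← Module.coe_length R R] at hdim
  exact_mod_cast hdim.symm

theorem jacobson_eq : Ring.jacobson R = Ideal.span {p} := by
  rw [ringJacobson_eq_maximalIdeal, h.maximalIdeal_eq]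

end IsUniformizer

section Height

variable {R : Type*} [CommRing R] {B D : Type*} [AddCommGroup B] [Module R B] [AddCommGroup D]
  [Module R D] {p : R}

/-- The submodule `p ^ l • B` of the elements of height at least `l`. -/
def heightGE (p : R) (B : Type*) [AddCommGroup B] [Module R B] (l : ℕ) : Submodule R B :=
  LinearMap.range (LinearMap.lsmul R B (p ^ l))

theorem mem_heightGE {l : ℕ} {x : B} : x ∈ heightGE p B l ↔ ∃ z, p ^ l • z = x :=
  Iff.rfl

theorem mem_heightGE_zero (x : B) : x ∈ heightGE p B 0 :=
  ⟨x, by rw [pow_zero, LinearMap.lsmul_apply, one_smul]⟩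

theorem mem_heightGE_succ {l : ℕ} {x : B} :
    x ∈ heightGE p B (l + 1) ↔ ∃ z ∈ heightGE p B l, p • z = x := by
  simp only [mem_heightGE, exists_exists_eq_and, pow_succ', mul_smul]

theorem heightGE_antitone : Antitone (heightGE p B) :=
  antitone_nat_of_succ_le fun l => by
    rintro _ ⟨z, rfl⟩
    exact ⟨p • z, by simp only [LinearMap.lsmul_apply, pow_succ, mul_smul]⟩

theorem map_mem_heightGE (f : B →ₗ[R] D) {l : ℕ} {x : B} (hx : x ∈ heightGE p B l) :
    f x ∈ heightGE p D l := by
  obtain ⟨z, rfl⟩ := hx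
  exact ⟨f z, (map_smul f _ z).symm⟩

theorem heightGE_eq_bot {n l : ℕ} (hp : p ^ n = 0) (hl : n ≤ l) : heightGE p B l = ⊥ := by
  rw [heightGE, pow_eq_zero_of_le hl hp, map_zero, LinearMap.range_zero]

theorem exists_mem_notMem_smul_mem {n : ℕ} (hp : p ^ n = 0) {S T : Submodule R B} (hST : ¬T ≤ S) :
    ∃ x ∈ T, x ∉ S ∧ p • x ∈ S := by
  by_contra! hcon
  have descend (m : ℕ) : ∀ x ∈ T, p ^ m • x ∈ S → x ∈ S := by
    induction m with
    | zero => exact fun x _ hx => by rwa [pow_zero, one_smul] at hx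
    | succ m ih =>
      intro x hxT hx
      rw [pow_succ, mul_smul] at hx
      by_contra hxS
      exact hcon x hxT hxS (ih _ (T.smul_mem p hxT) hx)
  exact hST fun x hx => descend n x hx (by rw [hp, zero_smul]; exact S.zero_mem)

theorem exists_maximal_height_in_coset {n : ℕ} (hp : p ^ n = 0) {S : Submodule R B} {x : B}
    (hx : x ∉ S) :
    ∃ s ∈ S, ∃ l, x + s ∈ heightGE p B l ∧ ∀ t ∈ S, x + s + t ∉ heightGE p B (l + 1) := by
  by_contra! hcon
  have climb (l : ℕ) : ∃ s ∈ S, x + s ∈ heightGE p B l := by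
    induction l with
    | zero => exact ⟨0, S.zero_mem, mem_heightGE_zero _⟩
    | succ l ih =>
      obtain ⟨s, hs, hxs⟩ := ih
      obtain ⟨t, ht, hxst⟩ := hcon s hs l hxs
      exact ⟨s + t, S.add_mem hs ht, by rwa [← add_assoc]⟩
  obtain ⟨s, hs, hxs⟩ := climb n
  rw [heightGE_eq_bot hp le_rfl, Submodule.mem_bot] at hxs
  exact hx (eq_neg_of_add_eq_zero_left hxs ▸ S.neg_mem hs)

/-- A linear relation `Γ ⊆ B × D` is height increasing if `y` has at least the height of `x` for all
`(x, y) ∈ Γ`. Such a relation extends to a linear map, see `IsHeightIncreasing.exists_linearMap`. -/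
def IsHeightIncreasing (p : R) (Γ : Submodule R (B × D)) : Prop :=
  ∀ z ∈ Γ, ∀ l, z.1 ∈ heightGE p B l → z.2 ∈ heightGE p D l

namespace IsHeightIncreasing

theorem sSup_of_isChain {c : Set (Submodule R (B × D))} (hc : IsChain (· ≤ ·) c)
    (hne : c.Nonempty) (h : ∀ Γ ∈ c, IsHeightIncreasing p Γ) : IsHeightIncreasing p (sSup c) := by
  intro z hz
  obtain ⟨Γ, hΓ, hzΓ⟩ := (Submodule.mem_sSup_of_directed hne hc.directedOn).1 hz
  exact h Γ hΓ z hzΓ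

theorem eq_zero {n : ℕ} (hp : p ^ n = 0) {Γ : Submodule R (B × D)} (hΓ : IsHeightIncreasing p Γ)
    {y : D} (hy : (0, y) ∈ Γ) : y = 0 := by
  have hyn := hΓ _ hy n (Submodule.zero_mem _)
  rwa [heightGE_eq_bot hp le_rfl, Submodule.mem_bot] at hyn

theorem map_lsmul {G : Submodule R (B × D)}
    (hsoc : ∀ x : B, p • x = 0 → ∃ y, (x, y) ∈ G)
    (hsoc_map : ∀ x y, (x, y) ∈ G → p • x = 0 → p • y = 0)
    (hlift : ∀ x y, (x, y) ∈ G → ∀ l, x ∈ heightGE p B l → ∃ y' ∈ heightGE p D l, (x, y') ∈ G) :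
    IsHeightIncreasing p (G.map (LinearMap.lsmul R (B × D) p)) := by
  rintro _ ⟨⟨x, y⟩, hxy, rfl⟩ (_ | l) hxl
  · exact mem_heightGE_zero _
  obtain ⟨x', hx'l, hx'⟩ := mem_heightGE_succ.1 hxl
  obtain ⟨y₀, hy₀⟩ := hsoc (x - x') (by rw [smul_sub, hx']; exact sub_self _)
  have hxG : (x', y - y₀) ∈ G := by
    simpa only [Prod.mk_sub_mk, sub_sub_cancel] using G.sub_mem hxy hy₀
  obtain ⟨y', hy'l, hxy'⟩ := hlift _ _ hxG l hx'l
  have hyy' : p • (y - y') = 0 :=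
    hsoc_map (x - x') _ (G.sub_mem hxy hxy') (by rw [smul_sub, hx']; exact sub_self _)
  exact mem_heightGE_succ.2 ⟨y', hy'l, (sub_eq_zero.1 (smul_sub p y y' ▸ hyy')).symm⟩

variable [IsLocalRing R] {n : ℕ} (h : IsUniformizer p n) {Γ Γ₀ G : Submodule R (B × D)}
include h

theorem sup_span (hΓ : IsHeightIncreasing p Γ) {x : B} {y : D} {l : ℕ} (hxy : (p • x, p • y) ∈ Γ)
    (hx : x ∈ heightGE p B l) (hy : y ∈ heightGE p D l)
    (hmax : ∀ z ∈ Γ, x + z.1 ∉ heightGE p B (l + 1)) :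
    IsHeightIncreasing p (Γ ⊔ Submodule.span R {(x, y)}) := by
  intro z hz m hm
  obtain ⟨s, hs, _, ht, rfl⟩ := Submodule.mem_sup.1 hz
  obtain ⟨a, rfl⟩ := Submodule.mem_span_singleton.1 ht
  by_cases hpa : p ∣ a
  · obtain ⟨b, rfl⟩ := hpa
    refine hΓ _ (Γ.add_mem hs ?_) m hm
    rw [mul_comm, mul_smul]
    exact Γ.smul_mem b hxy
  · obtain ⟨a, rfl⟩ := h.isUnit_of_not_dvd hpa
    have hml : m ≤ l := by
      by_contra! hlm
      refine hmax ((↑a⁻¹ : R) • s) (Γ.smul_mem _ hs) (heightGE_antitone (Nat.succ_le_of_lt hlm) ?_)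
      have hau : (↑a⁻¹ : R) • (s + (a : R) • (x, y)).1 = x + ((↑a⁻¹ : R) • s).1 := by
        simp only [Prod.fst_add, Prod.smul_fst, smul_add, smul_smul, Units.inv_mul, one_smul,
          add_comm]
      exact hau ▸ Submodule.smul_mem _ _ hm
    have hsm : s.1 ∈ heightGE p B m :=
      (Submodule.add_mem_iff_left _ (Submodule.smul_mem _ _ (heightGE_antitone hml hx))).1 hm
    exact Submodule.add_mem _ (hΓ s hs m hsm) (Submodule.smul_mem _ _ (heightGE_antitone hml hy))

theorem exists_extension (hΓ₀ : IsHeightIncreasing p Γ₀) (hle : Γ₀ ≤ G)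
    (step : ∀ Γ, Γ₀ ≤ Γ → IsHeightIncreasing p Γ → ∀ x ∈ G.map (LinearMap.fst R B D), ∀ t,
      (p • x, t) ∈ Γ → ∀ l, x ∈ heightGE p B l → ∃ y ∈ heightGE p D l, (x, y) ∈ G ∧ p • y = t) :
    ∃ Γ, Γ₀ ≤ Γ ∧ Γ ≤ G ∧ IsHeightIncreasing p Γ ∧
      G.map (LinearMap.fst R B D) ≤ Γ.map (LinearMap.fst R B D) := by
  obtain ⟨Γ, hΓ₀Γ, ⟨hΓG, hΓ⟩, hmax⟩ := zorn_le_nonempty₀ {Γ | Γ ≤ G ∧ IsHeightIncreasing p Γ}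
    (fun c hcs hc Γ hΓ => ⟨sSup c, ⟨sSup_le fun Δ hΔ => (hcs hΔ).1,
      sSup_of_isChain hc ⟨Γ, hΓ⟩ fun Δ hΔ => (hcs hΔ).2⟩, fun _ => le_sSup⟩) Γ₀ ⟨hle, hΓ₀⟩
  refine ⟨Γ, hΓ₀Γ, hΓG, hΓ, ?_⟩
  by_contra hdom
  obtain ⟨x, hxG, hx, hpx⟩ := exists_mem_notMem_smul_mem h.pow_eq_zero hdom
  obtain ⟨s, hs, l, hxl, hproper⟩ := exists_maximal_height_in_coset h.pow_eq_zero hx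
  have hxsG := Submodule.add_mem _ hxG (Submodule.map_mono hΓG hs)
  obtain ⟨⟨_, t⟩, ht, rfl⟩ : p • (x + s) ∈ Γ.map (LinearMap.fst R B D) :=
    smul_add p x s ▸ Submodule.add_mem _ hpx (Submodule.smul_mem _ p hs)
  obtain ⟨y, hyl, hyG, rfl⟩ := step Γ hΓ₀Γ hΓ _ hxsG t ht l hxl
  -- `x + s` has maximal height modulo the domain of `Γ`, so adjoining `(x + s, y)` is harmless.
  have hΓ' := hΓ.sup_span h ht hxl hyl fun z hz => hproper _ ⟨z, hz, rfl⟩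
  have hle' := hmax ⟨sup_le hΓG ((Submodule.span_singleton_le_iff_mem _ _).2 hyG), hΓ'⟩ le_sup_left
  have hxs : x + s ∈ Γ.map (LinearMap.fst R B D) :=
    ⟨_, hle' (Submodule.mem_sup_right (Submodule.mem_span_singleton_self _)), rfl⟩
  exact hx ((Submodule.add_mem_iff_left _ hs).1 hxs)

theorem exists_linearMap (hΓ₀ : IsHeightIncreasing p Γ₀) :
    ∃ f : B →ₗ[R] D, ∀ z ∈ Γ₀, f z.1 = z.2 := by
  obtain ⟨Γ, hle, -, hΓ, hdom⟩ := hΓ₀.exists_extension h (G := ⊤) le_top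
    fun Γ _ hΓ x _ t ht l hl => by
      obtain ⟨y, hy, hyt⟩ :=
        mem_heightGE_succ.1 (hΓ _ ht (l + 1) (mem_heightGE_succ.2 ⟨x, hl, rfl⟩))
      exact ⟨y, hy, Submodule.mem_top, hyt⟩
  have hfst : Function.Surjective (LinearMap.fst R B D ∘ₗ Γ.subtype) := fun x =>
    have ⟨z, hz, hzx⟩ := hdom ⟨(x, 0), Submodule.mem_top, rfl⟩
    ⟨⟨z, hz⟩, hzx⟩
  obtain ⟨f, hf⟩ := exists_semilinear_factor (σ₂₃ := .id R) hfst
    (g := LinearMap.snd R B D ∘ₗ Γ.subtype) (by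
      rintro ⟨⟨_, y⟩, hz⟩ rfl
      exact hΓ.eq_zero h.pow_eq_zero hz)
  exact ⟨f, fun z hz => hf ⟨z, hle hz⟩⟩

end IsHeightIncreasing

namespace IsUniformizer

variable [IsLocalRing R] {n : ℕ} (h : IsUniformizer p n) {G : Submodule R (B × D)}
include h

theorem exists_linearMap_of_relation (hsoc : ∀ x : B, p • x = 0 → ∃ y, (x, y) ∈ G)
    (hsoc_map : ∀ x y, (x, y) ∈ G → p • x = 0 → p • y = 0)
    (hlift : ∀ x y, (x, y) ∈ G → ∀ l, x ∈ heightGE p B l → ∃ y' ∈ heightGE p D l, (x, y') ∈ G) :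
    ∃ f : B →ₗ[R] D, ∀ z ∈ G, (z.1, f z.1) ∈ G := by
  have hpG : G.map (LinearMap.lsmul R (B × D) p) ≤ G := by
    rintro _ ⟨z, hz, rfl⟩
    exact G.smul_mem p hz
  obtain ⟨Γ, -, hΓG, hΓ, hdom⟩ :=
    (IsHeightIncreasing.map_lsmul hsoc hsoc_map hlift).exists_extension h hpG (by
      rintro Γ hle hΓ _ ⟨⟨x, y⟩, hxy, rfl⟩ t ht l hxl
      obtain ⟨y', hy'l, hxy'⟩ := hlift x y hxy l hxl
      have hpt : (0, p • y' - t) ∈ Γ := by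
        simpa using Γ.sub_mem (hle ⟨_, hxy', rfl⟩) ht
      exact ⟨y', hy'l, hxy', sub_eq_zero.1 (hΓ.eq_zero h.pow_eq_zero hpt)⟩)
  obtain ⟨f, hf⟩ := hΓ.exists_linearMap h
  refine ⟨f, fun z hz => ?_⟩
  obtain ⟨z', hz', hzz'⟩ := hdom ⟨z, hz, rfl⟩
  change z'.1 = z.1 at hzz'
  rw [← hzz', hf z' hz']
  exact hΓG hz'

end IsUniformizer

end Height

section Pairs

variable {Λ : Type u} [CommRing Λ] {k : Type w} [Field k] {p : Λ} {n : ℕ}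

namespace SubmodulePair

/-- The map `A⁺ → C⁺` induced by a morphism `(B; A) → (D; C)`. -/
def mapAplus {X Y : SubmodulePair Λ} (f : X ⟶ Y) : X.Aplus →ₗ[Λ] Y.Aplus :=
  (toLin f).restrict fun _ => map_mem_Aplus f

/-- The submodules of `B` that induce the subspaces of the representation `A⁺ / A⁻` of `𝒫_n`. -/
def posetSub (p : Λ) (n : ℕ) (X : SubmodulePair Λ) : PosetP n →o Submodule Λ X.B where
  toFun := Sum.elim (fun i => heightGE p X.B (OrderDual.ofDual i : Set.Ico 1 n))
    (Sum.elim (fun _ => X.soc) fun _ => X.A)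
  monotone' := by
    rintro (i | i | i) (j | j | j) hij
    · exact heightGE_antitone (show (OrderDual.ofDual j : Set.Ico 1 n) ≤ OrderDual.ofDual i from
        (Sum.inl_le_inl_iff.1 hij : i ≤ j))
    all_goals first | exact le_rfl | simp at hij

theorem Aminus_le_A (X : SubmodulePair Λ) : X.Aminus ≤ X.A :=
  Submodule.smul_le_right

theorem map_mem_soc {X Y : SubmodulePair Λ} (f : X ⟶ Y) {x : X.B} (hx : x ∈ X.soc) :
    toLin f x ∈ Y.soc := by
  rw [soc, Submodule.mem_torsionBySet_iff] at hx ⊢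
  exact fun a => by rw [← map_smul, hx a, map_zero]

theorem map_mem_posetSub {X Y : SubmodulePair Λ} (f : X ⟶ Y) {i : PosetP n} {x : X.B}
    (hx : x ∈ X.posetSub p n i) : toLin f x ∈ Y.posetSub p n i := by
  rcases i with i | i | i
  · exact map_mem_heightGE _ hx
  · exact map_mem_soc f hx
  · exact f.2 x hx

end SubmodulePair

namespace IsUniformizer

variable [IsLocalRing Λ] (h : IsUniformizer p n) {X : SubmodulePair Λ} {x : X.B}
include h

theorem mem_Aminus_iff : x ∈ X.Aminus ↔ ∃ a ∈ X.A, p • a = x := by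
  rw [SubmodulePair.Aminus, h.jacobson_eq, Submodule.ideal_span_singleton_smul,
    Submodule.mem_smul_pointwise_iff_exists]

theorem mem_soc_iff : x ∈ X.soc ↔ p • x = 0 := by
  rw [SubmodulePair.soc, h.jacobson_eq, Submodule.torsionBySet_ideal_span_singleton_eq,
    Submodule.mem_torsionBy_iff]

theorem bounded_iff {m : ℕ} : SubmodulePair.bounded Λ m X ↔ ∀ a ∈ X.A, p ^ m • a = 0 := by
  rw [SubmodulePair.bounded, h.jacobson_eq, Ideal.span_singleton_pow,
    Submodule.ideal_span_singleton_smul, Submodule.eq_bot_iff]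
  simp only [Submodule.mem_smul_pointwise_iff_exists, forall_exists_index, and_imp,
    forall_apply_eq_imp_iff₂]

theorem Aminus_le_soc (hX : SubmodulePair.bounded Λ 2 X) : X.Aminus ≤ X.soc := fun _ hx => by
  obtain ⟨a, ha, rfl⟩ := h.mem_Aminus_iff.1 hx
  rw [h.mem_soc_iff, smul_smul, ← sq]
  exact h.bounded_iff.1 hX a ha

theorem smul_mem_Aminus (hx : x ∈ X.Aplus) : p • x ∈ X.Aminus := by
  obtain ⟨a, ha, s, hs, rfl⟩ := Submodule.mem_sup.1 hx
  rw [smul_add, h.mem_soc_iff.1 hs, add_zero]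
  exact h.mem_Aminus_iff.2 ⟨a, ha, rfl⟩

end IsUniformizer

namespace PosetRep

/-- The filtration `V⁰ ⊇ V¹ ⊇ ⋯ ⊇ V^{n-1} ⊇ 0`, where `V^l = 0` for `l ≥ n`. -/
def filtration (V : PosetRep k (PosetP n)) (l : ℕ) : Submodule k V.total :=
  if l < n then V.level l else ⊥

variable (V : PosetRep k (PosetP n))

theorem filtration_of_lt {l : ℕ} (hl : l < n) : V.filtration l = V.level l :=
  if_pos hl

theorem filtration_of_le {l : ℕ} (hl : n ≤ l) : V.filtration l = ⊥ :=
  if_neg hl.not_gt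

theorem filtration_zero (hn : 0 < n) : V.filtration 0 = ⊤ := by
  rw [V.filtration_of_lt hn, level, dif_neg (by simp)]

theorem filtration_of_mem {l : ℕ} (hl : l ∈ Set.Ico 1 n) :
    V.filtration l = V.sub (Sum.inl (OrderDual.toDual ⟨l, hl⟩)) := by
  rw [V.filtration_of_lt hl.2, level, dif_pos hl]

theorem filtration_antitone : Antitone V.filtration := by
  intro l m hlm
  rcases lt_or_ge m n with hm | hm
  · rw [V.filtration_of_lt hm, V.filtration_of_lt (hlm.trans_lt hm), level, level]
    split_ifs with hm' hl' hl'
    · exact V.sub.monotone (Sum.inl_le_inl_iff.2 hlm)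
    · exact le_top
    · exact absurd ⟨hl'.1.trans hlm, hm⟩ hm'
    · exact le_rfl
  · rw [V.filtration_of_le hm]
    exact bot_le

theorem map_mem_filtration {V W : PosetRep k (PosetP n)} (φ : V ⟶ W) {l : ℕ} {v : V.total}
    (hv : v ∈ V.filtration l) : φ.1 v ∈ W.filtration l := by
  rcases le_or_gt n l with hnl | hln
  · rw [filtration_of_le _ hnl, Submodule.mem_bot] at hv ⊢
    rw [hv, map_zero]
  rcases l.eq_zero_or_pos with rfl | hl
  · rw [filtration_zero _ hln]
    exact Submodule.mem_top
  · rw [filtration_of_mem _ ⟨hl, hln⟩] at hv ⊢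
    exact φ.2 _ v hv

end PosetRep

end Pairs

section Presentation

variable {Λ : Type u} [CommRing Λ] {k : Type w} [Field k] {σ : Λ →+* k} {p : Λ} {n : ℕ}

/-- An identification of the representation `V` with `A⁺ / A⁻`, given by a semilinear map on `A⁺`
with kernel `A⁻` under which the subspaces of `V` are the images of the heights, of `soc B` and of
`A`. -/
structure PairPresentation (σ : Λ →+* k) (p : Λ) (X : SubmodulePair Λ)
    (V : PosetRep k (PosetP n)) where
  toMap : X.Aplus →ₛₗ[σ] V.total
  surjective : Function.Surjective toMap
  map_eq_zero_iff (a : X.Aplus) : toMap a = 0 ↔ (a : X.B) ∈ X.Aminus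
  mem_sub_iff (i : PosetP n) (v : V.total) :
    v ∈ V.sub i ↔ ∃ a : X.Aplus, (a : X.B) ∈ X.posetSub p n i ∧ toMap a = v

namespace PairPresentation

open SubmodulePair

variable {X Y Z : SubmodulePair Λ} {V W U : PosetRep k (PosetP n)} (P : PairPresentation σ p X V)
  (Q : PairPresentation σ p Y W) (T : PairPresentation σ p Z U)

include P in
theorem eq_iff {a b : X.Aplus} : P.toMap a = P.toMap b ↔ (a : X.B) - b ∈ X.Aminus := by
  rw [← sub_eq_zero, ← map_sub, P.map_eq_zero_iff]
  rfl

theorem toMap_mem_sub_iff {i : PosetP n} (hi : X.Aminus ≤ X.posetSub p n i) {a : X.Aplus} :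
    P.toMap a ∈ V.sub i ↔ (a : X.B) ∈ X.posetSub p n i := by
  refine ⟨fun ha => ?_, fun ha => (P.mem_sub_iff i _).2 ⟨a, ha, rfl⟩⟩
  obtain ⟨b, hb, hab⟩ := (P.mem_sub_iff i _).1 ha
  exact (Submodule.sub_mem_iff_left _ hb).1 (hi (P.eq_iff.1 hab.symm))

theorem hom_ext {φ ψ : V ⟶ W} (hφψ : ∀ a, φ.1 (P.toMap a) = ψ.1 (P.toMap a)) : φ = ψ :=
  Subtype.ext (LinearMap.ext (P.surjective.forall.2 hφψ))

section Map

variable [RingHomSurjective σ]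

theorem exists_map (f : X ⟶ Y) :
    ∃ φ : V ⟶ W, ∀ a, φ.1 (P.toMap a) = Q.toMap (mapAplus f a) := by
  obtain ⟨u, hu⟩ := exists_semilinear_factor (σ₂₃ := .id k) P.surjective
    (g := Q.toMap.comp (mapAplus f)) fun a ha =>
      (Q.map_eq_zero_iff _).2 (map_mem_Aminus f ((P.map_eq_zero_iff a).1 ha))
  refine ⟨⟨u, fun i v hv => ?_⟩, hu⟩
  obtain ⟨a, ha, rfl⟩ := (P.mem_sub_iff i v).1 hv
  exact (Q.mem_sub_iff i _).2 ⟨mapAplus f a, map_mem_posetSub f ha, (hu a).symm⟩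

/-- The morphism of representations `A⁺ / A⁻ → C⁺ / C⁻` induced by `(B; A) → (D; C)`. -/
noncomputable def map (f : X ⟶ Y) : V ⟶ W :=
  (P.exists_map Q f).choose

theorem map_apply (f : X ⟶ Y) (a : X.Aplus) :
    (P.map Q f).1 (P.toMap a) = Q.toMap (mapAplus f a) :=
  (P.exists_map Q f).choose_spec a

theorem map_id : P.map P (𝟙 X) = 𝟙 V :=
  P.hom_ext fun a => P.map_apply P (𝟙 X) a

theorem map_comp (f : X ⟶ Y) (g : Y ⟶ Z) : P.map T (f ≫ g) = P.map Q f ≫ Q.map T g :=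
  P.hom_ext fun a => (P.map_apply T (f ≫ g) a).trans
    ((congrArg (Q.map T g).1 (P.map_apply Q f a)).trans (Q.map_apply T g _)).symm

theorem map_add (f g : X ⟶ Y) : P.map Q (f + g) = P.map Q f + P.map Q g :=
  P.hom_ext fun a => (P.map_apply Q (f + g) a).trans ((Q.toMap.map_add _ _).trans
    (congrArg₂ (· + ·) (P.map_apply Q f a) (P.map_apply Q g a)).symm)

theorem map_eq_map_iff {f g : X ⟶ Y} :
    P.map Q f = P.map Q g ↔ ∀ b ∈ X.Aplus, toLin (f - g) b ∈ Y.Aminus := by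
  have hfg (a : X.Aplus) : (P.map Q f).1 (P.toMap a) = (P.map Q g).1 (P.toMap a) ↔
      toLin (f - g) (a : X.B) ∈ Y.Aminus := by
    rw [P.map_apply, P.map_apply, Q.eq_iff]
    rfl
  exact ⟨fun heq b hb => (hfg ⟨b, hb⟩).1 (by rw [heq]), fun hN => P.hom_ext fun a =>
    (hfg a).2 (hN a a.2)⟩

/-- The canonical isomorphism between two representations identified with the same `A⁺ / A⁻`. -/
noncomputable def iso (P : PairPresentation σ p X V) (P' : PairPresentation σ p X W) : V ≅ W where
  hom := P.map P' (𝟙 X)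
  inv := P'.map P (𝟙 X)
  hom_inv_id := by rw [← map_comp, Category.comp_id, map_id]
  inv_hom_id := by rw [← map_comp, Category.comp_id, map_id]

end Map

section Full

/-- The linear relation between `B` and `D` that a morphism of representations `A⁺ / A⁻ → C⁺ / C⁻`
defines. -/
def relation (φ : V ⟶ W) : Submodule Λ (X.B × Y.B) :=
  (LinearMap.eqLocus ((φ.1.comp P.toMap).comp (LinearMap.fst Λ X.Aplus Y.Aplus))
    (Q.toMap.comp (LinearMap.snd Λ X.Aplus Y.Aplus))).map
      (X.Aplus.subtype.prodMap Y.Aplus.subtype)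

theorem mem_relation_iff {φ : V ⟶ W} {x : X.B} {y : Y.B} :
    (x, y) ∈ P.relation Q φ ↔ ∃ (hx : x ∈ X.Aplus) (hy : y ∈ Y.Aplus),
      φ.1 (P.toMap ⟨x, hx⟩) = Q.toMap ⟨y, hy⟩ := by
  constructor
  · rintro ⟨⟨a, c⟩, hac, rfl, rfl⟩
    exact ⟨a.2, c.2, hac⟩
  · rintro ⟨hx, hy, hxy⟩
    exact ⟨(⟨x, hx⟩, ⟨y, hy⟩), hxy, rfl⟩

theorem mem_posetSub_of_mem_relation {φ : V ⟶ W} {i : PosetP n}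
    (hi : Y.Aminus ≤ Y.posetSub p n i) {x : X.B} {y : Y.B} (hxy : (x, y) ∈ P.relation Q φ)
    (hx : x ∈ X.posetSub p n i) : y ∈ Y.posetSub p n i := by
  obtain ⟨hx', hy', hφ⟩ := (P.mem_relation_iff Q).1 hxy
  refine (Q.toMap_mem_sub_iff hi (a := ⟨y, hy'⟩)).1 ?_
  exact hφ ▸ φ.2 i _ ((P.mem_sub_iff i _).2 ⟨⟨x, hx'⟩, hx, rfl⟩)

variable [IsLocalRing Λ] (h : IsUniformizer p n)
include h

theorem mem_filtration_iff {l : ℕ} {v : V.total} :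
    v ∈ V.filtration l ↔ ∃ a : X.Aplus, (a : X.B) ∈ heightGE p X.B l ∧ P.toMap a = v := by
  rcases le_or_gt n l with hnl | hln
  · rw [V.filtration_of_le hnl, heightGE_eq_bot h.pow_eq_zero hnl, Submodule.mem_bot]
    refine ⟨fun hv => ⟨0, Submodule.zero_mem _, hv ▸ map_zero _⟩, ?_⟩
    rintro ⟨a, ha, rfl⟩
    rw [P.map_eq_zero_iff, (Submodule.mem_bot Λ).1 ha]
    exact Submodule.zero_mem _
  rcases l.eq_zero_or_pos with rfl | hl
  · rw [V.filtration_zero hln]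
    obtain ⟨a, rfl⟩ := P.surjective v
    exact iff_of_true Submodule.mem_top ⟨a, mem_heightGE_zero _, rfl⟩
  · rw [V.filtration_of_mem ⟨hl, hln⟩]
    exact P.mem_sub_iff _ v

include P in
theorem restricted : PosetRep.restricted k n V := by
  constructor
  · intro v hv
    rw [← V.filtration_of_lt (Nat.sub_lt h.pos one_pos), P.mem_filtration_iff h] at hv
    obtain ⟨a, ⟨z, hz⟩, rfl⟩ := hv
    refine (P.mem_sub_iff _ _).2 ⟨a, h.mem_soc_iff.2 ?_, rfl⟩
    rw [← hz, LinearMap.lsmul_apply, smul_smul, mul_pow_sub_one h.pos.ne', h.pow_eq_zero, zero_smul]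
  · refine eq_top_iff.2 fun v _ => ?_
    obtain ⟨⟨_, hx⟩, rfl⟩ := P.surjective v
    obtain ⟨a, ha, s, hs, rfl⟩ := Submodule.mem_sup.1 hx
    let a' : X.Aplus := ⟨a, Submodule.mem_sup_left ha⟩
    let s' : X.Aplus := ⟨s, Submodule.mem_sup_right hs⟩
    rw [show (⟨a + s, hx⟩ : X.Aplus) = s' + a' from Subtype.ext (add_comm a s), _root_.map_add]
    exact Submodule.add_mem_sup ((P.mem_sub_iff _ _).2 ⟨s', hs, rfl⟩)
      ((P.mem_sub_iff _ _).2 ⟨a', ha, rfl⟩)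

theorem exists_linearMap_mem_relation (hY : SubmodulePair.bounded Λ 2 Y) (φ : V ⟶ W) :
    ∃ f : X.B →ₗ[Λ] Y.B, ∀ z ∈ P.relation Q φ, (z.1, f z.1) ∈ P.relation Q φ := by
  refine h.exists_linearMap_of_relation (fun x hx => ?_) (fun x y hxy hx => ?_)
    fun x y hxy l hxl => ?_
  · have hx' : x ∈ X.Aplus := Submodule.mem_sup_right (h.mem_soc_iff.2 hx)
    obtain ⟨c, hc⟩ := Q.surjective (φ.1 (P.toMap ⟨x, hx'⟩))
    exact ⟨c, (P.mem_relation_iff Q).2 ⟨hx', c.2, hc.symm⟩⟩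
  · exact h.mem_soc_iff.1 (P.mem_posetSub_of_mem_relation Q (i := .inr (.inl ()))
      (h.Aminus_le_soc hY) hxy (h.mem_soc_iff.2 hx))
  · obtain ⟨hx, -, -⟩ := (P.mem_relation_iff Q).1 hxy
    obtain ⟨c, hc, hxc⟩ := (Q.mem_filtration_iff h).1
      (PosetRep.map_mem_filtration φ ((P.mem_filtration_iff h).2 ⟨⟨x, hx⟩, hxl, rfl⟩))
    exact ⟨c, hc, (P.mem_relation_iff Q).2 ⟨hx, c.2, hxc.symm⟩⟩

theorem exists_map_eq [RingHomSurjective σ] (hY : SubmodulePair.bounded Λ 2 Y) (φ : V ⟶ W) :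
    ∃ f : X ⟶ Y, P.map Q f = φ := by
  obtain ⟨f, hf⟩ := P.exists_linearMap_mem_relation Q h hY φ
  have hfrel (a : X.Aplus) : ((a : X.B), f a) ∈ P.relation Q φ := by
    obtain ⟨c, hc⟩ := Q.surjective (φ.1 (P.toMap a))
    exact hf _ ((P.mem_relation_iff Q).2 ⟨a.2, c.2, hc.symm⟩)
  have hfA (x : X.B) (hx : x ∈ X.A) : f x ∈ Y.A :=
    P.mem_posetSub_of_mem_relation Q (i := .inr (.inr ())) Y.Aminus_le_A
      (hfrel ⟨x, Submodule.mem_sup_left hx⟩) hx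
  refine ⟨⟨f, hfA⟩, P.hom_ext fun a => ?_⟩
  obtain ⟨_, _, hφ⟩ := (P.mem_relation_iff Q).1 (hfrel a)
  exact (P.map_apply Q _ a).trans hφ.symm

end Full

end PairPresentation

section Existence

theorem exists_semilinear_coordinates {R : Type*} [Ring R] {σ : R →+* k} [RingHomSurjective σ]
    {M : Type*} [AddCommGroup M] [Module R M] [Module.Finite R M] {N : Submodule R M}
    (hN : ∀ r, σ r = 0 → ∀ x : M, r • x ∈ N) :
    ∃ (d : ℕ) (c : M →ₛₗ[σ] (Fin d → k)), Function.Surjective c ∧ ∀ x, c x = 0 ↔ x ∈ N := by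
  have hσ : Function.Surjective σ := RingHomSurjective.is_surjective
  have hker : RingHom.ker σ ≤ RingHom.ker (Module.toAddMonoidEnd R (M ⧸ N)) := fun r hr =>
    AddMonoidHom.ext <| N.mkQ_surjective.forall.2 fun x =>
      (Submodule.Quotient.mk_eq_zero N).2 (hN r hr x)
  let _ : Module k (M ⧸ N) := Module.compHom _ (σ.liftOfSurjective hσ ⟨_, hker⟩)
  have smul_def (r : R) (q : M ⧸ N) : σ r • q = r • q :=
    DFunLike.congr_fun (σ.liftOfRightInverse_comp_apply
      (Function.surjInv hσ) (Function.rightInverse_surjInv hσ)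
      ⟨Module.toAddMonoidEnd R (M ⧸ N), hker⟩ r) q
  let π : M →ₛₗ[σ] (M ⧸ N) :=
    { N.mkQ.toAddMonoidHom with map_smul' := fun r x => (smul_def r (N.mkQ x)).symm }
  have hπ : Function.Surjective π := N.mkQ_surjective
  have : Module.Finite k (M ⧸ N) := Module.Finite.of_surjective π hπ
  let e := (Module.finBasis k (M ⧸ N)).equivFun
  exact ⟨_, e.toLinearMap.comp π, e.surjective.comp hπ, fun x =>
    (LinearEquiv.map_eq_zero_iff e).trans (Submodule.Quotient.mk_eq_zero N)⟩

theorem IsUniformizer.exists_pairPresentation [RingHomSurjective σ] [IsLocalRing Λ]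
    (h : IsUniformizer p n) (X : SubmodulePair Λ) :
    ∃ V : PosetRep k (PosetP n), Nonempty (PairPresentation σ p X V) := by
  have : IsNoetherianRing Λ := h.isNoetherianRing
  obtain ⟨d, c, hc, hker⟩ := exists_semilinear_coordinates (σ := σ)
    (N := X.Aminus.comap X.Aplus.subtype) fun r hr a => by
      obtain ⟨s, rfl⟩ := (h.map_eq_zero_iff σ).1 hr
      rw [mul_smul]
      exact h.smul_mem_Aminus (s • a).2
  let V : PosetRep k (PosetP n) :=
    { total := Fin d → k
      sub := ⟨fun i => ((X.posetSub p n i).comap X.Aplus.subtype).map c, fun _ _ hij =>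
        Submodule.map_mono (Submodule.comap_mono ((X.posetSub p n).monotone hij))⟩ }
  exact ⟨V, ⟨c, hc, hker, fun _ _ => Iff.rfl⟩⟩

end Existence

end Presentation

section AdaptedBasis

variable {R : Type*} [Ring R] {V : Type*} [AddCommGroup V] [Module R V] {ι : Type*}
  {b : Module.Basis ι R V}

theorem mem_span_basis_image_iff {s : Set ι} {v : V} :
    v ∈ Submodule.span R (b '' s) ↔ ∀ i ∉ s, b.repr v i = 0 := by
  rw [b.mem_span_image, Finsupp.support_subset_iff]

theorem inf_sup_eq_of_map_mkQ_le {U T W : Submodule R V} (hTU : T ≤ U)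
    (hUT : U.map W.mkQ ≤ T.map W.mkQ) : W ⊓ U ⊔ T = U := by
  rw [LinearMap.map_le_map_iff, Submodule.ker_mkQ] at hUT
  rw [sup_comm, ← sup_inf_assoc_of_le W hTU, inf_eq_right]
  exact hUT

/-- A basis `b` with levels `lev` is adapted to a filtration `F` if the step `F l` is spanned by the
basis vectors of level at least `l`. -/
def IsAdaptedBasis (b : Module.Basis ι R V) (F : ℕ → Submodule R V) (lev : ι → ℕ) : Prop :=
  ∀ l, F l = Submodule.span R (b '' {i | l ≤ lev i})

namespace IsAdaptedBasis

variable {F : ℕ → Submodule R V} {lev : ι → ℕ}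

theorem basis_mem (h : IsAdaptedBasis b F lev) (i : ι) : b i ∈ F (lev i) :=
  (h (lev i)).ge (Submodule.subset_span ⟨i, le_refl (lev i), rfl⟩)

theorem mem_iff (h : IsAdaptedBasis b F lev) {l : ℕ} {v : V} :
    v ∈ F l ↔ ∀ i, lev i < l → b.repr v i = 0 := by
  rw [h l, mem_span_basis_image_iff]
  simp only [Set.mem_ofPred_eq, not_le]

theorem exists_sum {ι₁ ι₂ : Type*} (hF : Antitone F) (hF₀ : F 0 = ⊤)
    {W : Submodule R V} {b₁ : Module.Basis ι₁ R W} {b₂ : Module.Basis ι₂ R (V ⧸ W)}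
    {lev₁ : ι₁ → ℕ} {lev₂ : ι₂ → ℕ}
    (h₁ : IsAdaptedBasis b₁ (fun l => (F l).comap W.subtype) lev₁)
    (h₂ : IsAdaptedBasis b₂ (fun l => (F l).map W.mkQ) lev₂) :
    ∃ b : Module.Basis (ι₁ ⊕ ι₂) R V, IsAdaptedBasis b F (Sum.elim lev₁ lev₂) ∧
      Submodule.span R (b '' Set.range Sum.inl) = W := by
  choose e he heq using h₂.basis_mem
  let g : ι₁ ⊕ ι₂ → V := Sum.elim (W.subtype ∘ b₁) e
  have hspan (l : ℕ) : Submodule.span R (g '' {i | l ≤ Sum.elim lev₁ lev₂ i}) = F l := by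
    have himage : g '' {i | l ≤ Sum.elim lev₁ lev₂ i} =
        W.subtype '' (b₁ '' {i | l ≤ lev₁ i}) ∪ e '' {j | l ≤ lev₂ j} := by
      ext v
      simp only [g, Set.mem_image, Set.mem_union, Set.mem_ofPred_eq, Sum.exists, Sum.elim_inl,
        Sum.elim_inr, Function.comp_apply, exists_exists_and_eq_and]
    rw [himage, Submodule.span_union, Submodule.span_image, ← h₁ l, Submodule.map_comap_subtype]
    refine inf_sup_eq_of_map_mkQ_le (Submodule.span_le.2 ?_) ?_
    · rintro _ ⟨j, hj, rfl⟩
      exact hF hj (he j)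
    · refine (h₂ l).trans_le ?_
      rw [Submodule.map_span, Set.image_image]
      exact Submodule.span_mono (Set.image_congr fun j _ => heq j).ge
  have hli : LinearIndependent R g :=
    b₁.linearIndependent.sumElim_of_quotient e ((funext heq : W.mkQ ∘ e = b₂) ▸
      b₂.linearIndependent)
  have htop : ⊤ ≤ Submodule.span R (Set.range g) := by
    rw [← hF₀, ← hspan 0]
    exact Submodule.span_mono (Set.image_subset_range _ _)
  refine ⟨Module.Basis.mk hli htop, fun l => ?_, ?_⟩
  · rw [Module.Basis.coe_mk, hspan]
  · rw [Module.Basis.coe_mk, ← Set.range_comp, Sum.elim_comp_inl, Set.range_comp,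
      Submodule.span_image, b₁.span_eq, Submodule.map_top, Submodule.range_subtype]

end IsAdaptedBasis

variable {K : Type*} [DivisionRing K]

theorem exists_isAdaptedBasis (n : ℕ) : ∀ {V : Type v} [AddCommGroup V] [Module K V]
    [Module.Finite K V] {F : ℕ → Submodule K V}, Antitone F → F 0 = ⊤ → F n = ⊥ →
    ∃ (ι : Type) (b : Module.Basis ι K V) (lev : ι → ℕ), IsAdaptedBasis b F lev := by
  induction n with
  | zero =>
    intro V _ _ _ F _ hF₀ hFn
    have : Subsingleton V :=
      (Submodule.subsingleton_iff K).1 (subsingleton_of_bot_eq_top (hFn.symm.trans hF₀))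
    exact ⟨Empty, Module.Basis.empty V, Empty.elim, fun _ => Subsingleton.elim _ _⟩
  | succ n ih =>
    intro V _ _ _ F hF hF₀ hFn
    obtain ⟨ι, b₂, lev, h₂⟩ := ih (F := fun l => (F l).map (F n).mkQ)
      (fun _ _ hlm => Submodule.map_mono (hF hlm))
      (by rw [hF₀, Submodule.map_top, Submodule.range_mkQ]) (Submodule.mkQ_map_self _)
    let b₁ := Module.finBasis K (F n)
    have h₁ : IsAdaptedBasis b₁ (fun l => (F l).comap (F n).subtype) fun _ => n := by
      intro l
      rcases le_or_gt l n with hl | hl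
      · simp only [hl, Set.ofPred_true, Set.image_univ, b₁.span_eq, Submodule.comap_subtype_eq_top]
        exact hF hl
      · simp only [hl.not_ge, Set.ofPred_false, Set.image_empty, Submodule.span_empty,
          eq_bot_mono (hF hl) hFn, Submodule.comap_bot, Submodule.ker_subtype]
    obtain ⟨b, hb, -⟩ := h₁.exists_sum hF hF₀ h₂
    exact ⟨_, b, _, hb⟩

theorem exists_isAdaptedBasis_span_eq {V : Type v} [AddCommGroup V] [Module K V]
    [Module.Finite K V] {n : ℕ} {F : ℕ → Submodule K V} (hF : Antitone F) (hF₀ : F 0 = ⊤)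
    (hFn : F n = ⊥) (W : Submodule K V) :
    ∃ (ι : Type) (b : Module.Basis ι K V) (lev : ι → ℕ) (s : Set ι), IsAdaptedBasis b F lev ∧
      Submodule.span K (b '' s) = W := by
  obtain ⟨ι₁, b₁, lev₁, h₁⟩ := exists_isAdaptedBasis n (F := fun l => (F l).comap W.subtype)
    (fun _ _ hlm => Submodule.comap_mono (hF hlm)) (by rw [hF₀, Submodule.comap_top])
    (by rw [hFn, Submodule.comap_bot, Submodule.ker_subtype])
  obtain ⟨ι₂, b₂, lev₂, h₂⟩ := exists_isAdaptedBasis n (F := fun l => (F l).map W.mkQ)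
    (fun _ _ hlm => Submodule.map_mono (hF hlm))
    (by rw [hF₀, Submodule.map_top, Submodule.range_mkQ]) (by rw [hFn, Submodule.map_bot])
  obtain ⟨b, hb, hW⟩ := h₁.exists_sum hF hF₀ h₂
  exact ⟨_, b, _, _, hb, hW⟩

end AdaptedBasis

section Density

variable {Λ : Type u} [CommRing Λ] {k : Type w} [Field k] {σ : Λ →+* k} {p : Λ} {n : ℕ}

/-- Compatibility conditions on maps `γ : L → B` and `δ : L → V⁰` which ensure that `V` is the
representation `A⁺ / A⁻` of the pair `(B; A)` with `A = γ(δ⁻¹(V''))`, identified by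
`γ a ↦ δ a`. -/
structure IsPairModel (p : Λ) (V : PosetRep k (PosetP n)) {L B : Type*} [AddCommGroup L]
    [Module Λ L] [AddCommGroup B] [Module Λ B] (γ : L →ₗ[Λ] B) (δ : L →ₛₗ[σ] V.total) : Prop where
  surjective : Function.Surjective δ
  exists_smul_eq (a : L) : δ a = 0 → ∃ b, p • b = a
  map_eq_zero (a : L) : γ a = 0 → δ a = 0
  smul_eq_zero_iff (a : L) : p • γ a = 0 ↔ δ a ∈ V.prime
  mem_range (x : B) : p • x = 0 → ∃ a, γ a = x
  mem_filtration_iff (l : ℕ) (v : V.total) :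
    v ∈ V.filtration l ↔ ∃ a, γ a ∈ heightGE p B l ∧ δ a = v

namespace IsPairModel

variable {V : PosetRep k (PosetP n)} {L : Type*} {B : Type u} [AddCommGroup L] [Module Λ L]
  [AddCommGroup B] [Module Λ B] {γ : L →ₗ[Λ] B} {δ : L →ₛₗ[σ] V.total}

/-- The pair `(B; A)` with `A = γ(δ⁻¹(V''))`. -/
def pair [Module.Finite Λ B] (γ : L →ₗ[Λ] B) (δ : L →ₛₗ[σ] V.total) : SubmodulePair Λ where
  B := B
  A := (V.dprime.comap δ).map γ

variable (M : IsPairModel p V γ δ)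
include M

theorem exists_add_eq (hV : V.prime ⊔ V.dprime = ⊤) (a : L) :
    ∃ a₁ a₂, a₁ + a₂ = a ∧ δ a₁ ∈ V.prime ∧ δ a₂ ∈ V.dprime := by
  obtain ⟨v₁, hv₁, v₂, hv₂, hv⟩ := Submodule.mem_sup.1 (hV ▸ Submodule.mem_top : δ a ∈ _)
  obtain ⟨a₁, rfl⟩ := M.surjective v₁
  refine ⟨a₁, a - a₁, add_sub_cancel a₁ a, hv₁, ?_⟩
  rwa [map_sub, ← hv, add_sub_cancel_left]

variable [Module.Finite Λ B] [IsLocalRing Λ] (h : IsUniformizer p n)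
include h

theorem mem_soc_iff {a : L} : γ a ∈ (pair γ δ).soc ↔ δ a ∈ V.prime :=
  h.mem_soc_iff.trans (M.smul_eq_zero_iff a)

theorem bounded : SubmodulePair.bounded Λ 2 (pair γ δ) := by
  rw [h.bounded_iff]
  rintro _ ⟨a, -, rfl⟩
  have hpa : δ (p • a) = 0 := by
    rw [map_smulₛₗ, (h.map_eq_zero_iff σ).2 dvd_rfl, zero_smul]
  change p ^ 2 • γ a = 0
  rw [sq, mul_smul, ← map_smul, M.smul_eq_zero_iff, hpa]
  exact Submodule.zero_mem _

theorem map_mem_Aplus (hV : V.prime ⊔ V.dprime = ⊤) (a : L) : γ a ∈ (pair γ δ).Aplus := by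
  obtain ⟨a₁, a₂, rfl, h₁, h₂⟩ := M.exists_add_eq hV a
  rw [map_add, add_comm]
  exact Submodule.add_mem_sup (S := (pair γ δ).A) ⟨a₂, h₂, rfl⟩ ((M.mem_soc_iff h).2 h₁)

theorem exists_map_eq {x : (pair γ δ).B} (hx : x ∈ (pair γ δ).Aplus) : ∃ a, γ a = x := by
  obtain ⟨_, ⟨a, -, rfl⟩, y, hy, rfl⟩ := Submodule.mem_sup.1 hx
  obtain ⟨b, rfl⟩ := M.mem_range y (h.mem_soc_iff.1 hy)
  exact ⟨a + b, map_add γ a b⟩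

theorem mem_Aminus_iff (hV : V.prime ⊔ V.dprime = ⊤) {a : L} :
    γ a ∈ (pair γ δ).Aminus ↔ δ a = 0 := by
  refine h.mem_Aminus_iff.trans ⟨?_, fun ha => ?_⟩
  · rintro ⟨_, ⟨b, -, rfl⟩, hab⟩
    have hδ := M.map_eq_zero (a - p • b) (by rw [map_sub, map_smul]; exact sub_eq_zero.2 hab.symm)
    rwa [map_sub, map_smulₛₗ, (h.map_eq_zero_iff σ).2 dvd_rfl, zero_smul, sub_zero] at hδ
  · obtain ⟨b, rfl⟩ := M.exists_smul_eq a ha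
    obtain ⟨b₁, b₂, rfl, h₁, h₂⟩ := M.exists_add_eq hV b
    refine ⟨γ b₂, ⟨b₂, h₂, rfl⟩, ?_⟩
    rw [map_smul, map_add, smul_add, (M.smul_eq_zero_iff b₁).2 h₁, zero_add]
    rfl

theorem mem_sub_iff {i : PosetP n} {v : V.total} :
    v ∈ V.sub i ↔ ∃ a, γ a ∈ (pair γ δ).posetSub p n i ∧ δ a = v := by
  rcases i with i | i | i
  · have hi := (OrderDual.ofDual i).2
    exact (V.filtration_of_mem hi) ▸ M.mem_filtration_iff _ v
  · refine ⟨fun hv => ?_, ?_⟩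
    · obtain ⟨a, rfl⟩ := M.surjective v
      exact ⟨a, (M.mem_soc_iff h).2 hv, rfl⟩
    · rintro ⟨a, ha, rfl⟩
      exact (M.mem_soc_iff h).1 ha
  · refine ⟨fun hv => ?_, ?_⟩
    · obtain ⟨a, rfl⟩ := M.surjective v
      exact ⟨a, ⟨a, hv, rfl⟩, rfl⟩
    · rintro ⟨a, ⟨b, hb, hab⟩, rfl⟩
      have hδ := M.map_eq_zero (b - a) (by rw [map_sub, hab, sub_self])
      rw [map_sub, sub_eq_zero] at hδ
      exact hδ ▸ hb

theorem nonempty_pairPresentation (hV : V.prime ⊔ V.dprime = ⊤) :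
    Nonempty (PairPresentation σ p (pair γ δ) V) := by
  let γ' : L →ₗ[Λ] (pair γ δ).Aplus := γ.codRestrict _ (M.map_mem_Aplus h hV)
  have hγ' : Function.Surjective γ' := fun x =>
    have ⟨a, ha⟩ := M.exists_map_eq h x.2
    ⟨a, Subtype.ext ha⟩
  obtain ⟨c, hc⟩ := exists_semilinear_factor (σ₂₃ := σ) hγ' (g := δ) fun a ha =>
    M.map_eq_zero a (congrArg Subtype.val ha)
  refine ⟨⟨c, fun v => ?_, hγ'.forall.2 fun a => ?_, fun i v => ?_⟩⟩
  · obtain ⟨a, rfl⟩ := M.surjective v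
    exact ⟨γ' a, hc a⟩
  · rw [hc]
    exact (M.mem_Aminus_iff h hV).symm
  · rw [M.mem_sub_iff h, hγ'.exists]
    simp only [hc]
    rfl

end IsPairModel

section CyclicSum

variable {ι : Type*} {m : ι → ℕ}

/-- The direct sum of the cyclic modules `Λ / (p ^ m i)`. -/
abbrev CyclicSum (p : Λ) (m : ι → ℕ) : Type _ :=
  (ι → Λ) ⧸ (Submodule.pi Set.univ fun i => Ideal.span {p ^ m i} : Submodule Λ (ι → Λ))

theorem mk_cyclicSum_eq_zero_iff {x : ι → Λ} :
    (Submodule.Quotient.mk x : CyclicSum p m) = 0 ↔ ∀ i, p ^ m i ∣ x i := by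
  simp only [Submodule.Quotient.mk_eq_zero, Submodule.mem_pi, Set.mem_univ, true_imp_iff,
    Ideal.mem_span_singleton]

variable [Finite ι] {E : Type*} [AddCommGroup E] [Module k E] (b : Module.Basis ι k E)

/-- The map `a ↦ ∑ i, σ (a i) • b i`. -/
noncomputable def semilinearCombination (σ : Λ →+* k) : (ι → Λ) →ₛₗ[σ] E where
  toFun a := b.equivFun.symm (σ ∘ a)
  map_add' a a' := by
    rw [← map_add]
    exact congrArg _ (funext fun i => map_add σ (a i) (a' i))
  map_smul' r a := by
    rw [← map_smul]
    exact congrArg _ (funext fun i => map_mul σ r (a i))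

theorem repr_semilinearCombination (a : ι → Λ) (i : ι) :
    b.repr (semilinearCombination b σ a) i = σ (a i) :=
  congrFun (b.equivFun.apply_symm_apply (σ ∘ a)) i

theorem semilinearCombination_eq_iff {a : ι → Λ} {v : E} :
    semilinearCombination b σ a = v ↔ ∀ i, σ (a i) = b.repr v i := by
  simp only [b.ext_elem_iff, repr_semilinearCombination]

end CyclicSum

section CyclicModel

variable {ι : Type} {lev : ι → ℕ} {s : Set ι}

open Classical in
/-- The exponents of the cyclic summands of the module `B` constructed from a representation: they
are such that the element `p ^ lev i` of `Λ / (p ^ m i)` lies in the socle precisely if `i ∈ s`. -/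
noncomputable def cyclicExponent (lev : ι → ℕ) (s : Set ι) (i : ι) : ℕ :=
  lev i + 1 + if i ∈ s then 0 else 1

/-- The map `(a i) ↦ (p ^ lev i * a i)` to the direct sum of cyclic modules. -/
def cyclicMap (p : Λ) (lev : ι → ℕ) (s : Set ι) :
    (ι → Λ) →ₗ[Λ] CyclicSum p (cyclicExponent lev s) :=
  Submodule.mkQ _ ∘ₗ LinearMap.mulLeft Λ fun i => p ^ lev i

theorem cyclicMap_mem_heightGE {a : ι → Λ} {l : ℕ} (ha : ∀ i, lev i < l → a i = 0) :
    cyclicMap p lev s a ∈ heightGE p _ l := by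
  refine ⟨Submodule.Quotient.mk fun i => p ^ (lev i - l) * a i,
    congrArg Submodule.Quotient.mk (funext fun i => ?_)⟩
  change p ^ l * (p ^ (lev i - l) * a i) = p ^ lev i * a i
  rcases lt_or_ge (lev i) l with hi | hi
  · rw [ha i hi, mul_zero, mul_zero, mul_zero]
  · rw [← mul_assoc, ← pow_add, Nat.add_sub_cancel' hi]

section Exponent

variable {V : PosetRep k (PosetP n)} {b : Module.Basis ι k V.total}

theorem cyclicExponent_le (hb : IsAdaptedBasis b V.filtration lev)
    (hs : Submodule.span k (b '' s) = V.prime) (hV : V.level (n - 1) ≤ V.prime) (i : ι) :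
    cyclicExponent lev s i ≤ n := by
  have hlev : lev i < n := lt_of_not_ge fun hi => b.ne_zero i <| by
    simpa only [V.filtration_of_le hi, Submodule.mem_bot] using hb.basis_mem i
  rw [cyclicExponent]
  split_ifs with his
  · exact hlev
  suffices lev i ≠ n - 1 by lia
  intro hi
  have hbi : b i ∈ V.level (n - 1) := by
    rw [← V.filtration_of_lt (by lia), ← hi]
    exact hb.basis_mem i
  exact his (b.self_mem_span_image.1 (hs ▸ hV hbi))

end Exponent

variable [IsLocalRing Λ] (h : IsUniformizer p n) (hm : ∀ i, cyclicExponent lev s i ≤ n)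
include h hm

theorem dvd_of_cyclicMap_eq_zero {a : ι → Λ} (ha : cyclicMap p lev s a = 0) (i : ι) : p ∣ a i := by
  have hi := mk_cyclicSum_eq_zero_iff.1 ha i
  have hmi := hm i
  rw [cyclicExponent, add_assoc] at hi hmi
  exact (dvd_pow_self p (by lia)).trans ((h.pow_add_dvd_pow_mul_iff hmi).1 hi)

theorem smul_cyclicMap_eq_zero_iff {a : ι → Λ} :
    p • cyclicMap p lev s a = 0 ↔ ∀ i ∉ s, p ∣ a i := by
  have heq : p • cyclicMap p lev s a =
      Submodule.Quotient.mk fun i => p ^ (lev i + 1) * a i := by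
    refine congrArg Submodule.Quotient.mk (funext fun i => ?_)
    change p * (p ^ lev i * a i) = _
    rw [pow_succ', mul_assoc]
  rw [heq, mk_cyclicSum_eq_zero_iff]
  refine forall_congr' fun i => (h.pow_add_dvd_pow_mul_iff (hm i)).trans ?_
  split_ifs with his <;> simp [his]

theorem exists_cyclicMap_eq {x : CyclicSum p (cyclicExponent lev s)} (hx : p • x = 0) :
    ∃ a, cyclicMap p lev s a = x := by
  obtain ⟨y, rfl⟩ := Submodule.Quotient.mk_surjective _ x
  have hy (i : ι) : p ^ lev i ∣ y i := by
    have hi : p ^ cyclicExponent lev s i ∣ p * y i := mk_cyclicSum_eq_zero_iff.1 hx i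
    have hmi := hm i
    rw [cyclicExponent, add_assoc, add_left_comm] at hi hmi
    exact (pow_dvd_pow p (Nat.le_add_right _ _)).trans
      ((h.pow_add_dvd_pow_mul_iff hmi).1 ((pow_one p).symm ▸ hi))
  choose a ha using hy
  exact ⟨a, congrArg Submodule.Quotient.mk (funext fun i => (ha i).symm)⟩

theorem dvd_of_cyclicMap_mem_heightGE {a : ι → Λ} {l : ℕ}
    (ha : cyclicMap p lev s a ∈ heightGE p _ l) {i : ι} (hi : lev i < l) : p ∣ a i := by
  obtain ⟨z, hz⟩ := mem_heightGE.1 ha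
  obtain ⟨z, rfl⟩ := Submodule.Quotient.mk_surjective _ z
  have hdiff : p ^ cyclicExponent lev s i ∣ p ^ lev i * a i - p ^ l * z i :=
    mk_cyclicSum_eq_zero_iff.1 (sub_eq_zero.2 hz.symm) i
  have hmul : p ^ (lev i + 1) ∣ p ^ lev i * a i :=
    (dvd_sub_left ((pow_dvd_pow p hi).mul_right _)).1
      ((pow_dvd_pow p (Nat.le_add_right _ _)).trans hdiff)
  have hdvd := (h.pow_add_dvd_pow_mul_iff ((Nat.le_add_right _ _).trans (hm i))).1 hmul
  rwa [pow_one] at hdvd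

theorem isPairModel_cyclicMap [Finite ι] (hσ : Function.Surjective σ) {V : PosetRep k (PosetP n)}
    {b : Module.Basis ι k V.total} (hb : IsAdaptedBasis b V.filtration lev)
    (hs : Submodule.span k (b '' s) = V.prime) :
    IsPairModel p V (cyclicMap p lev s) (semilinearCombination b σ) where
  surjective v := by
    choose a ha using fun i => hσ (b.repr v i)
    exact ⟨a, (semilinearCombination_eq_iff b).2 ha⟩
  exists_smul_eq a ha := by
    rw [semilinearCombination_eq_iff] at ha
    simp only [map_zero, Finsupp.zero_apply, h.map_eq_zero_iff] at ha
    choose c hc using ha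
    exact ⟨c, funext fun i => (hc i).symm⟩
  map_eq_zero a ha := (semilinearCombination_eq_iff b).2 fun i => by
    rw [(h.map_eq_zero_iff σ).2 (dvd_of_cyclicMap_eq_zero h hm ha i), map_zero, Finsupp.zero_apply]
  smul_eq_zero_iff a := by
    rw [smul_cyclicMap_eq_zero_iff h hm, ← hs, mem_span_basis_image_iff]
    simp only [repr_semilinearCombination, h.map_eq_zero_iff]
  mem_range x := exists_cyclicMap_eq h hm
  mem_filtration_iff l v := by
    rw [hb.mem_iff]
    constructor
    · intro hv
      have hlift (i : ι) : ∃ c, σ c = b.repr v i ∧ (lev i < l → c = 0) := by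
        by_cases hi : lev i < l
        · exact ⟨0, by rw [map_zero, hv i hi], fun _ => rfl⟩
        · exact (hσ (b.repr v i)).imp fun c hc => ⟨hc, fun hi' => absurd hi' hi⟩
      choose a ha ha₀ using hlift
      exact ⟨a, cyclicMap_mem_heightGE ha₀, (semilinearCombination_eq_iff b).2 ha⟩
    · rintro ⟨a, ha, rfl⟩ i hi
      rw [repr_semilinearCombination, h.map_eq_zero_iff]
      exact dvd_of_cyclicMap_mem_heightGE h hm ha hi

end CyclicModel

theorem IsUniformizer.exists_boundedPair [RingHomSurjective σ] [IsLocalRing Λ]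
    (h : IsUniformizer p n) (V : RepPrime k n) :
    ∃ X : BoundedPair Λ 2, Nonempty (PairPresentation σ p X.obj V.obj) := by
  obtain ⟨ι, b, lev, s, hb, hs⟩ := exists_isAdaptedBasis_span_eq V.obj.filtration_antitone
    (V.obj.filtration_zero h.pos) (V.obj.filtration_of_le le_rfl) V.obj.prime
  have : Finite ι := Module.Finite.finite_basis b
  have M := isPairModel_cyclicMap (σ := σ) h (cyclicExponent_le hb hs V.property.1)
    RingHomSurjective.is_surjective hb hs
  exact ⟨⟨_, M.bounded h⟩, M.nonempty_pairPresentation h V.property.2⟩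

end Density

section Equivalence

namespace IsUniformizer

variable {Λ : Type u} [CommRing Λ] [IsLocalRing Λ] {p : Λ} {n : ℕ} (h : IsUniformizer p n)
  {k : Type w} [Field k] (σ : Λ →+* k) [RingHomSurjective σ]

/-- The representation `A⁺ / A⁻` of a pair `(B; A)`. -/
noncomputable def rep (X : BoundedPair Λ 2) : PosetRep k (PosetP n) :=
  (h.exists_pairPresentation (σ := σ) X.obj).choose

/-- The identification of `h.rep σ X` with `A⁺ / A⁻`. -/
noncomputable def presentation (X : BoundedPair Λ 2) : PairPresentation σ p X.obj (h.rep σ X) :=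
  (h.exists_pairPresentation X.obj).choose_spec.some

/-- The functor `(B; A) ↦ A⁺ / A⁻`. -/
noncomputable def repFunctor : BoundedPair Λ 2 ⥤ RepPrime k n :=
  (PosetRep.restricted k n).lift
    { obj := h.rep σ
      map {X Y} f := (h.presentation σ X).map (h.presentation σ Y) f.hom
      map_id X := (h.presentation σ X).map_id
      map_comp {X Y Z} f g :=
        (h.presentation σ X).map_comp (h.presentation σ Y) (h.presentation σ Z) f.hom g.hom }
    fun X => (h.presentation σ X).restricted h

instance : (h.repFunctor σ).Additive where
  map_add {X Y f g} := ObjectProperty.hom_ext _ <|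
    (h.presentation σ X).map_add (h.presentation σ Y) f.hom g.hom

instance : (h.repFunctor σ).Full where
  map_surjective {X Y} φ := by
    obtain ⟨f, hf⟩ :=
      (h.presentation σ X).exists_map_eq (h.presentation σ Y) h Y.property φ.hom
    exact ⟨⟨f⟩, ObjectProperty.hom_ext _ hf⟩

instance : (h.repFunctor σ).EssSurj where
  mem_essImage V := by
    obtain ⟨X, ⟨P⟩⟩ := h.exists_boundedPair (σ := σ) V
    exact ⟨X, ⟨ObjectProperty.isoMk _ ((h.presentation σ X).iso P)⟩⟩

theorem repFunctor_map_eq_iff {X Y : BoundedPair Λ 2} {f g : X ⟶ Y} :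
    (h.repFunctor σ).map f = (h.repFunctor σ).map g ↔ BoundedPair.relN Λ f g := by
  rw [← (PosetRep.restricted k n).ι.map_injective.eq_iff]
  exact (h.presentation σ X).map_eq_map_iff (h.presentation σ Y)

/-- The functor induced by `(B; A) ↦ A⁺ / A⁻` on the factor category. -/
noncomputable def quotientFunctor : S2ModN Λ ⥤ RepPrime k n :=
  CategoryTheory.Quotient.lift (BoundedPair.relN Λ) (h.repFunctor σ) fun _ _ _ _ =>
    (h.repFunctor_map_eq_iff σ).2

instance : (h.quotientFunctor σ).Additive where
  map_add {X Y f g} := by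
    obtain ⟨f, rfl⟩ := (Quotient.functor (BoundedPair.relN Λ)).map_surjective f
    obtain ⟨g, rfl⟩ := (Quotient.functor (BoundedPair.relN Λ)).map_surjective g
    exact (h.repFunctor σ).map_add

instance : (h.quotientFunctor σ).Faithful where
  map_injective {X Y f g} hfg := by
    obtain ⟨f, rfl⟩ := (Quotient.functor (BoundedPair.relN Λ)).map_surjective f
    obtain ⟨g, rfl⟩ := (Quotient.functor (BoundedPair.relN Λ)).map_surjective g
    exact CategoryTheory.Quotient.sound _ ((h.repFunctor_map_eq_iff σ).1 hfg)

instance : (h.quotientFunctor σ).Full where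
  map_surjective φ :=
    have ⟨f, hf⟩ := (h.repFunctor σ).map_surjective φ
    ⟨(Quotient.functor (BoundedPair.relN Λ)).map f, hf⟩

instance : (h.quotientFunctor σ).EssSurj where
  mem_essImage V :=
    have ⟨X, hX⟩ := Functor.EssSurj.mem_essImage (F := h.repFunctor σ) V
    ⟨(Quotient.functor (BoundedPair.relN Λ)).obj X, hX⟩

end IsUniformizer

theorem IsUniformizer.additivelyEquivalent {Λ : Type u} [CommRing Λ] [IsLocalRing Λ] {p : Λ}
    {n : ℕ} (h : IsUniformizer p n) {k : Type w} [Field k] {σ : Λ →+* k}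
    (hσ : Function.Surjective σ) : AdditivelyEquivalent (S2ModN Λ) (RepPrime k n) :=
  have : RingHomSurjective σ := ⟨hσ⟩
  have : (h.quotientFunctor σ).IsEquivalence := {}
  ⟨(h.quotientFunctor σ).asEquivalence, inferInstanceAs (h.quotientFunctor σ).Additive⟩

theorem AdditivelyEquivalent.trans_symm {C : Type*} [Category* C] [Preadditive C] {D : Type*}
    [Category* D] [Preadditive D] {E : Type*} [Category* E] [Preadditive E]
    (hC : AdditivelyEquivalent C E) (hD : AdditivelyEquivalent D E) : AdditivelyEquivalent C D := by
  obtain ⟨e, he⟩ := hC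
  obtain ⟨e', he'⟩ := hD
  have := e'.inverse_additive
  exact ⟨e.trans e'.symm, inferInstanceAs (e.functor ⋙ e'.inverse).Additive⟩

end Equivalence

section Uniserial

variable {R : Type u} [CommRing R] {n : ℕ}

theorem IsUniserialRing.isBezout (hR : IsUniserialRing R) : IsBezout R :=
  IsBezout.iff_span_pair_isPrincipal.2 fun x y => by
    rw [Ideal.span_insert]
    rcases hR (Ideal.span {x}) (Ideal.span {y}) with hxy | hyx
    · exact ⟨y, sup_eq_right.2 hxy⟩
    · exact ⟨x, sup_eq_left.2 hyx⟩

theorem IsUniserialRing.exists_isUniformizer [IsLocalRing R] (hR : IsUniserialRing R)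
    (hn : Module.length R R = n) : ∃ p : R, IsUniformizer p n := by
  obtain ⟨hnoeth, hart⟩ := isFiniteLength_iff_isNoetherian_isArtinian.1
    (Module.length_ne_top_iff.1 (hn.trans_ne (ENat.natCast_ne_top n)))
  have : IsNoetherianRing R := hnoeth
  have : IsArtinianRing R := hart
  have : IsBezout R := hR.isBezout
  obtain ⟨p, hp⟩ := IsPrincipalIdealRing.principal (maximalIdeal R)
  have hnil : IsNilpotent p := by
    have hspan := (isArtinianRing_iff_isNilpotent_maximalIdeal R).1 hart
    simpa [IsNilpotent, hp, Ideal.span_singleton_pow] using hspan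
  have h : IsUniformizer p (nilpotencyClass p) := ⟨hp, fun m =>
    ⟨fun hm => Nat.sInf_le hm, fun hm => pow_eq_zero_of_le hm (pow_nilpotencyClass hnil)⟩⟩
  obtain rfl : nilpotencyClass p = n := by exact_mod_cast h.length_eq.symm.trans hn
  exact ⟨p, h⟩

theorem exists_isUniformizer_of_isMaximal_span {p : R} (hp : (Ideal.span {p}).IsMaximal)
    (hpow : ∀ m, p ^ m = 0 ↔ n ≤ m) : ∃ _ : IsLocalRing R, IsUniformizer p n := by
  have hlocal : IsLocalRing R := .of_unique_max_ideal ⟨_, hp, fun J hJ => by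
    have hpJ : p ^ n ∈ J := by rw [(hpow n).2 le_rfl]; exact J.zero_mem
    have hle := (Ideal.span_singleton_le_iff_mem J).2 (hJ.isPrime.mem_of_pow_mem n hpJ)
    exact (hp.eq_of_le hJ.ne_top hle).symm⟩
  exact ⟨hlocal, (eq_maximalIdeal hp).symm, hpow⟩

theorem exists_isUniformizer_of_ker_eq {S : Type*} [CommRing S] [IsDomain S]
    [IsPrincipalIdealRing S] {q : S} (hq : Irreducible q) (hn : 0 < n) {τ : S →+* R}
    (hτ : Function.Surjective τ) (hker : RingHom.ker τ = Ideal.span {q ^ n}) :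
    ∃ _ : IsLocalRing R, IsUniformizer (τ q) n := by
  have hle : RingHom.ker τ ≤ Ideal.span {q} := by
    rw [hker, Ideal.span_singleton_le_span_singleton]
    exact dvd_pow_self q hn.ne'
  have hmax := PrincipalIdealRing.isMaximal_of_irreducible hq
  refine exists_isUniformizer_of_isMaximal_span ?_ fun m => ?_
  · rw [← Set.image_singleton, ← Ideal.map_span]
    exact hmax.map_of_surjective_of_ker_le hτ hle
  · rw [← map_pow, ← RingHom.mem_ker, hker, Ideal.mem_span_singleton,
      pow_dvd_pow_iff hq.ne_zero hq.not_isUnit]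

theorem additivelyEquivalent_zmod (p : ℕ) [hp : Fact p.Prime] (hn : 0 < n) :
    AdditivelyEquivalent (S2ModN (ZMod (p ^ n))) (RepPrime (ZMod p) n) := by
  obtain ⟨_, h⟩ := exists_isUniformizer_of_ker_eq (Nat.prime_iff_prime_int.1 hp.out).irreducible hn
    (ZMod.ringHom_surjective (Int.castRingHom (ZMod (p ^ n))))
    (by rw [ZMod.ker_intCastRingHom, Nat.cast_pow])
  exact h.additivelyEquivalent (ZMod.castHom_surjective (dvd_pow_self p hn.ne'))

open Polynomial in
theorem additivelyEquivalent_polynomial (k : Type w) [Field k] (hn : 0 < n) :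
    AdditivelyEquivalent (S2ModN (k[X] ⧸ Ideal.span {(X : k[X]) ^ n})) (RepPrime k n) := by
  obtain ⟨_, h⟩ := exists_isUniformizer_of_ker_eq (irreducible_X (R := k)) hn
    Ideal.Quotient.mk_surjective (Ideal.mk_ker (I := Ideal.span {X ^ n}))
  have hker (f : k[X]) (hf : f ∈ Ideal.span {X ^ n}) : constantCoeff f = 0 := by
    rw [constantCoeff_apply, ← X_dvd_iff]
    exact (dvd_pow_self X hn.ne').trans (Ideal.mem_span_singleton.1 hf)
  refine h.additivelyEquivalent (Ideal.Quotient.lift_surjective_of_surjective _ hker fun c => ?_)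
  exact ⟨C c, coeff_C_zero⟩

end Uniserial

theorem mainTheorem2 :
    (∀ (Λ : Type u) [CommRing Λ] [IsLocalRing Λ] (Δ : Type v) [CommRing Δ] [IsLocalRing Δ]
        (k : Type w) [Field k] (n : ℕ),
      IsUniserialRing Λ → Module.length Λ Λ = n →
      IsUniserialRing Δ → Module.length Δ Δ = n →
      Nonempty (IsLocalRing.ResidueField Λ ≃+* k) →
      Nonempty (IsLocalRing.ResidueField Δ ≃+* k) →
        AdditivelyEquivalent (S2ModN Λ) (RepPrime k n) ∧
        AdditivelyEquivalent (S2ModN Δ) (RepPrime k n) ∧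
        AdditivelyEquivalent (S2ModN Λ) (S2ModN Δ)) ∧
    (∀ (p n : ℕ), p.Prime → 0 < n →
      AdditivelyEquivalent (S2ModN (ZMod (p ^ n)))
        (S2ModN (Polynomial (ZMod p) ⧸
          Ideal.span {(Polynomial.X : Polynomial (ZMod p)) ^ n}))) := by
  refine ⟨?_, fun p n hp hn => ?_⟩
  · intro Λ _ _ Δ _ _ k _ n hΛ hΛn hΔ hΔn ⟨eΛ⟩ ⟨eΔ⟩
    obtain ⟨p, hp⟩ := hΛ.exists_isUniformizer hΛn
    obtain ⟨q, hq⟩ := hΔ.exists_isUniformizer hΔn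
    have hΛk : AdditivelyEquivalent (S2ModN Λ) (RepPrime k n) :=
      hp.additivelyEquivalent (σ := eΛ.toRingHom.comp (residue Λ))
        (eΛ.surjective.comp residue_surjective)
    have hΔk : AdditivelyEquivalent (S2ModN Δ) (RepPrime k n) :=
      hq.additivelyEquivalent (σ := eΔ.toRingHom.comp (residue Δ))
        (eΔ.surjective.comp residue_surjective)
    exact ⟨hΛk, hΔk, hΛk.trans_symm hΔk⟩
  · have : Fact p.Prime := ⟨hp⟩
    exact (additivelyEquivalent_zmod p hn).trans_symm (additivelyEquivalent_polynomial (ZMod p) hn)
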